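/- For $A\subset\mathbb{R}^n$ Lebesgue measurable and a cube $Q\subset\mathbb{R}^n$ write $D(Q)=|A\cap Q|/|Q|$ and let $l(Q)$ be the sidelength of $Q$. Two cubes $Q,Q'$ with $l(Q)=l(Q')$ are called consecutive if the intersection of their closures is one of their ($(n-1)$-dimensional) faces. The set $A$ is called smooth if $$\lim_{\delta\to0^+}\ \sup |D(Q)-D(Q')| = 0,$$ where the supremum is taken over all pairs of consecutive cubes $Q,Q'$ with sides parallel to the coordinate axes and $l(Q)=l(Q')\le\delta$. A dyadic cube is a cube of the form $\prod_{i=1}^n [m_i2^{-k},(m_i+1)2^{-k}]$ with $k,m_1,\dots,m_n\in\mathbb{Z}$. Let $A$ be a measurable set in $\mathbb{R}^n$. The following are equivalent: (a) For every $\varepsilon>0$ there exists $\delta>0$ such that $|D(Q)-D(Q')|\le\varepsilon$ for every pair of consecutive dyadic cubes $Q,Q'$ of the same sidelength $l(Q)=l(Q')<\delta$. (b) For every $\varepsilon>0$ there exists $\delta>0$ such that $|D(Q)-D(Q')|\le\varepsilon$ for every pair of consecutive cubes $Q,Q'$, with sides not necessarily parallel to the axes, of the same sidelength $l(Q)=l(Q')<\delta$.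 (c) $A$ is a smooth set. -/

import Mathlib

open MeasureTheory Filter Topology

/-- A (closed) cube in Euclidean space, with sides not necessarily parallel to the axes: it is given
by a vertex `corner`, an orthonormal basis `frame` of edge directions starting at that vertex, and
the sidelength `side > 0`. -/
structure EuclCube (n : ℕ) where
  corner : EuclideanSpace ℝ (Fin n)
  frame : OrthonormalBasis (Fin n) ℝ (EuclideanSpace ℝ (Fin n))
  side : ℝ
  side_pos : 0 < side

namespace EuclCube

variable {n : ℕ}

/-- The set of points of the cube. -/
def toSet (Q : EuclCube n) : Set (EuclideanSpace ℝ (Fin n)) :=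
  {x | ∀ i, inner ℝ (Q.frame i) (x - Q.corner) ∈ Set.Icc 0 Q.side}

/-- `F` is one of the `2n` faces, of dimension `n - 1`, of the cube `Q`. -/
def IsFace (Q : EuclCube n) (F : Set (EuclideanSpace ℝ (Fin n))) : Prop :=
  ∃ i, F = {x ∈ Q.toSet | inner ℝ (Q.frame i) (x - Q.corner) = 0} ∨
    F = {x ∈ Q.toSet | inner ℝ (Q.frame i) (x - Q.corner) = Q.side}

/-- Two cubes of the same sidelength are consecutive if the intersection of their closures is one of
their faces (that is, a face of both). -/
def Consecutive (Q Q' : EuclCube n) : Prop :=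
  Q.side = Q'.side ∧ Q.IsFace (closure Q.toSet ∩ closure Q'.toSet) ∧
    Q'.IsFace (closure Q.toSet ∩ closure Q'.toSet)

/-- The cube has its sides parallel to the coordinate axes. Such a cube is described by its
lowermost vertex, from which the edges leave in the directions of the standard basis. -/
def IsAxisParallel (Q : EuclCube n) : Prop :=
  Q.frame = EuclideanSpace.basisFun (Fin n) ℝ

/-- Dyadic cubes: the products of the intervals `[m i * 2 ^ (-k), (m i + 1) * 2 ^ (-k)]`, with
integers `k` and `m i`. -/
def IsDyadic (Q : EuclCube n) : Prop :=
  Q.IsAxisParallel ∧ ∃ (k : ℤ) (m : Fin n → ℤ),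
    Q.side = (2 : ℝ) ^ (-k) ∧ ∀ i, Q.corner i = (m i : ℝ) * (2 : ℝ) ^ (-k)

/-- The density `D(Q) = |A ∩ Q| / |Q|` of the set `A` in the cube `Q`. -/
noncomputable def density (A : Set (EuclideanSpace ℝ (Fin n))) (Q : EuclCube n) : ℝ :=
  volume.real (A ∩ Q.toSet) / volume.real Q.toSet

end EuclCube

/-- The supremum of `|D(Q) - D(Q')|` over all pairs of consecutive axis-parallel cubes of sidelength
at most `δ` (formed in `[0, ∞]`). -/
noncomputable def smoothModulus {n : ℕ} (A : Set (EuclideanSpace ℝ (Fin n))) (δ : ℝ) : ENNReal :=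
  ⨆ (Q : EuclCube n) (Q' : EuclCube n) (_ : Q.IsAxisParallel) (_ : Q'.IsAxisParallel)
    (_ : Q.Consecutive Q') (_ : Q.side ≤ δ), ENNReal.ofReal |Q.density A - Q'.density A|

/-- Smooth sets: Lebesgue measurable sets for which the above supremum tends to `0` with `δ`. -/
def IsSmoothSet {n : ℕ} (A : Set (EuclideanSpace ℝ (Fin n))) : Prop :=
  NullMeasurableSet A volume ∧ Tendsto (smoothModulus A) (𝓝[>] 0) (𝓝 0)

/-!
The substantial implication is from dyadic cubes to arbitrary ones. Let `Q`, `Q'` be consecutive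
cubes of sidelength `l`, and cut space into half-open dyadic cells of sidelength `h`, where `l / h`
lies between `2 ^ J` and `2 ^ (J + 1)`.

* Cells which lie in `Q` or `Q'` are joined to a cell near a common point of `Q` and `Q'` by a chain
  of consecutive cells, whose length is bounded in terms of `n` and `J` (`abs_sub_le_of_step`). So,
  once `l` is small, the densities of `A` in all these cells are as close as we please to a single
  number `c`.
* The cells inside `Q` fill `Q` up to a proportion `2 n (n h) / l`, since they cover the cube
  obtained from `Q` by moving every face inwards by `n h`, which bounds the diameter of a cell.
  Hence the density of `A` in `Q` differs from `c` by little more than the densities in the cells do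
  (`EuclCube.abs_density_sub_le`), and likewise for `Q'`.

Choosing first `J` large and then `l` small makes both errors small. No orientation of the cubes
enters, because only the volume and the diameter of `Q` are used. The other implications specialise
to smaller families of cubes.
-/

/-! ### Boxes along an orthonormal basis -/

/-- Volume of a product set in the coordinates of an arbitrary orthonormal frame. -/
theorem volume_setOf_inner_sub_mem {n : ℕ}
    (b : OrthonormalBasis (Fin n) ℝ (EuclideanSpace ℝ (Fin n)))
    (c : EuclideanSpace ℝ (Fin n)) (s : Fin n → Set ℝ) :
    volume {x : EuclideanSpace ℝ (Fin n) | ∀ i, inner ℝ (b i) (x - c) ∈ s i} =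
      ∏ i, volume (s i) := by
  have h1 : {x : EuclideanSpace ℝ (Fin n) | ∀ i, inner ℝ (b i) (x - c) ∈ s i} =
      MeasurableEquiv.subRight c ⁻¹' (b.measurableEquiv ⁻¹'
        ((MeasurableEquiv.toLp 2 (Fin n → ℝ)).symm ⁻¹' (Set.univ.pi s))) := by
    ext x
    have hx : MeasurableEquiv.subRight c x = x - c := rfl
    simp [hx, OrthonormalBasis.measurableEquiv, ← b.repr_apply_apply]
  have h2 : MeasurePreserving (MeasurableEquiv.subRight c) volume volume :=
    measurePreserving_sub_right (volume : Measure (EuclideanSpace ℝ (Fin n))) c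
  rw [h1, h2.measure_preimage_equiv,
    b.measurePreserving_measurableEquiv.measure_preimage_equiv,
    (EuclideanSpace.volume_preserving_symm_measurableEquiv_toLp (Fin n)).measure_preimage_equiv,
    volume_pi_pi]

/-- A vector whose coordinates in an orthonormal basis are at most `t` has norm at most `n t`. -/
theorem norm_le_of_abs_inner_le {n : ℕ}
    (b : OrthonormalBasis (Fin n) ℝ (EuclideanSpace ℝ (Fin n)))
    {v : EuclideanSpace ℝ (Fin n)} {t : ℝ} (hv : ∀ i, |inner ℝ (b i) v| ≤ t) :
    ‖v‖ ≤ n * t := by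
  calc ‖v‖ = ‖∑ i, inner ℝ (b i) v • b i‖ := by rw [b.sum_repr']
    _ ≤ ∑ i, ‖inner ℝ (b i) v • b i‖ := norm_sum_le _ _
    _ ≤ ∑ _i : Fin n, t := Finset.sum_le_sum fun i _ => by
        simpa [norm_smul, b.norm_eq_one] using hv i
    _ = n * t := by simp

theorem abs_inner_le_norm {n : ℕ}
    (b : OrthonormalBasis (Fin n) ℝ (EuclideanSpace ℝ (Fin n)))
    (v : EuclideanSpace ℝ (Fin n)) (i : Fin n) : |inner ℝ (b i) v| ≤ ‖v‖ := by
  simpa [b.norm_eq_one] using abs_real_inner_le_norm (b i) v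

/-! ### Geometry of cubes -/

namespace EuclCube

variable {n : ℕ}

theorem isClosed_toSet (Q : EuclCube n) : IsClosed Q.toSet := by
  simp only [toSet, Set.ofPred_forall]
  exact isClosed_iInter fun i => isClosed_Icc.preimage (by fun_prop)

theorem volume_real_toSet (Q : EuclCube n) : volume.real Q.toSet = Q.side ^ n := by
  rw [measureReal_def, toSet, volume_setOf_inner_sub_mem Q.frame Q.corner]
  simp [ENNReal.toReal_pow, ENNReal.toReal_ofReal Q.side_pos.le]

theorem volume_toSet_ne_top (Q : EuclCube n) : volume Q.toSet ≠ ⊤ := by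
  rw [toSet, volume_setOf_inner_sub_mem Q.frame Q.corner]
  simp

theorem norm_sub_le {Q : EuclCube n} {x y : EuclideanSpace ℝ (Fin n)} (hx : x ∈ Q.toSet)
    (hy : y ∈ Q.toSet) : ‖x - y‖ ≤ n * Q.side := by
  refine norm_le_of_abs_inner_le Q.frame fun i => ?_
  have h1 := hx i
  have h2 := hy i
  rw [show x - y = (x - Q.corner) - (y - Q.corner) by abel, inner_sub_right]
  rw [abs_le]
  constructor <;> linarith [h1.1, h1.2, h2.1, h2.2]

theorem IsFace.nonempty {Q : EuclCube n} {F : Set (EuclideanSpace ℝ (Fin n))}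
    (hF : Q.IsFace F) : F.Nonempty := by
  obtain ⟨i, rfl | rfl⟩ := hF
  · exact ⟨Q.corner, fun j => by simp [Q.side_pos.le], by simp⟩
  · have key (j : Fin n) : inner ℝ (Q.frame j) (Q.corner + Q.side • Q.frame i - Q.corner) =
        if j = i then Q.side else 0 := by
      rw [add_sub_cancel_left, inner_smul_right, Q.frame.inner_eq_ite]
      simp
    refine ⟨Q.corner + Q.side • Q.frame i, fun j => ?_, by rw [key]; simp⟩
    rw [key]
    split_ifs <;> simp [Q.side_pos.le]

/-- Consecutive cubes share a point, because a face is never empty. -/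
theorem Consecutive.exists_mem {Q Q' : EuclCube n} (h : Q.Consecutive Q') :
    ∃ p, p ∈ Q.toSet ∧ p ∈ Q'.toSet := by
  obtain ⟨p, hp⟩ := h.2.1.nonempty
  rw [Q.isClosed_toSet.closure_eq, Q'.isClosed_toSet.closure_eq] at hp
  exact ⟨p, hp.1, hp.2⟩

end EuclCube

/-! ### The grid of mesh `h` -/

/-- The vertex `h z` of the grid of mesh `h`. -/
noncomputable def gridPoint {n : ℕ} (h : ℝ) (z : Fin n → ℤ) : EuclideanSpace ℝ (Fin n) :=
  WithLp.toLp 2 fun i => z i * h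

/-- The cell of the grid of mesh `h` with lowermost vertex `h z`. It is half-open, so that the
cells are pairwise disjoint. -/
def gridCell {n : ℕ} (h : ℝ) (z : Fin n → ℤ) : Set (EuclideanSpace ℝ (Fin n)) :=
  {x | ∀ i, inner ℝ (EuclideanSpace.basisFun (Fin n) ℝ i) (x - gridPoint h z) ∈ Set.Ico 0 h}

/-- The closed grid cube of mesh `h` with lowermost vertex `h z`. -/
noncomputable def gridCube {n : ℕ} (h : ℝ) (hh : 0 < h) (z : Fin n → ℤ) : EuclCube n where
  corner := gridPoint h z
  frame := EuclideanSpace.basisFun (Fin n) ℝ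
  side := h
  side_pos := hh

section Grid

variable {n : ℕ} {h : ℝ}

theorem mem_gridCell {z : Fin n → ℤ} {x : EuclideanSpace ℝ (Fin n)} :
    x ∈ gridCell h z ↔ ∀ i, z i * h ≤ x i ∧ x i < z i * h + h := by
  simp [gridCell, gridPoint, EuclideanSpace.inner_single_left, sub_lt_iff_lt_add']

theorem mem_gridCube {hh : 0 < h} {z : Fin n → ℤ} {x : EuclideanSpace ℝ (Fin n)} :
    x ∈ (gridCube h hh z).toSet ↔ ∀ i, z i * h ≤ x i ∧ x i ≤ z i * h + h := by
  simp [gridCube, EuclCube.toSet, gridPoint, EuclideanSpace.inner_single_left, add_comm]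

theorem gridPoint_mem_gridCell (hh : 0 < h) (z : Fin n → ℤ) : gridPoint h z ∈ gridCell h z := by
  intro i
  simp [hh]

theorem exists_mem_gridCell (hh : 0 < h) (x : EuclideanSpace ℝ (Fin n)) :
    ∃ z, x ∈ gridCell h z := by
  refine ⟨fun i => ⌊x i / h⌋, mem_gridCell.2 fun i => ⟨?_, ?_⟩⟩
  · exact (le_div_iff₀ hh).1 (Int.floor_le _)
  · have := (div_lt_iff₀ hh).1 (Int.lt_floor_add_one (x i / h))
    linarith

theorem eq_of_mem_gridCell (hh : 0 < h) {z w : Fin n → ℤ} {x : EuclideanSpace ℝ (Fin n)}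
    (hz : x ∈ gridCell h z) (hw : x ∈ gridCell h w) : z = w := by
  have key {z : Fin n → ℤ} (hz : x ∈ gridCell h z) (i : Fin n) : ⌊x i / h⌋ = z i := by
    have := mem_gridCell.1 hz i
    rw [Int.floor_eq_iff, le_div_iff₀ hh, div_lt_iff₀ hh]
    exact ⟨this.1, by linarith [this.2]⟩
  funext i
  rw [← key hz, ← key hw]

theorem norm_sub_le_of_mem_gridCell {z : Fin n → ℤ} {x y : EuclideanSpace ℝ (Fin n)}
    (hx : x ∈ gridCell h z) (hy : y ∈ gridCell h z) : ‖x - y‖ ≤ n * h := by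
  refine norm_le_of_abs_inner_le (EuclideanSpace.basisFun (Fin n) ℝ) fun i => ?_
  have h1 := hx i
  have h2 := hy i
  rw [show x - y = (x - gridPoint h z) - (y - gridPoint h z) by abel, inner_sub_right, abs_le]
  constructor <;> linarith [h1.1, h1.2, h2.1, h2.2]

theorem measurableSet_gridCell (z : Fin n → ℤ) : MeasurableSet (gridCell h z) := by
  simp only [gridCell, Set.ofPred_forall]
  exact MeasurableSet.iInter fun i => measurableSet_Ico.preimage (by fun_prop)

theorem volume_gridCell (z : Fin n → ℤ) : volume (gridCell h z) = ENNReal.ofReal h ^ n := by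
  rw [gridCell, volume_setOf_inner_sub_mem]
  simp

theorem volume_real_gridCell (hh : 0 < h) (z : Fin n → ℤ) :
    volume.real (gridCell h z) = h ^ n := by
  rw [measureReal_def, volume_gridCell, ENNReal.toReal_pow, ENNReal.toReal_ofReal hh.le]

theorem gridCell_ae_eq_gridCube (hh : 0 < h) (z : Fin n → ℤ) :
    gridCell h z =ᵐ[volume] (gridCube h hh z).toSet := by
  refine ae_eq_of_subset_of_measure_ge (fun x hx i => Set.Ico_subset_Icc_self (hx i)) ?_
    (measurableSet_gridCell z).nullMeasurableSet (gridCube h hh z).volume_toSet_ne_top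
  rw [volume_gridCell, EuclCube.toSet, volume_setOf_inner_sub_mem]
  simp [gridCube]

theorem density_gridCube (A : Set (EuclideanSpace ℝ (Fin n))) (hh : 0 < h) (z : Fin n → ℤ) :
    (gridCube h hh z).density A = (volume.restrict A).real (gridCell h z) / h ^ n := by
  rw [EuclCube.density, EuclCube.volume_real_toSet,
    measureReal_restrict_apply (measurableSet_gridCell z), Set.inter_comm]
  congr 1
  exact measureReal_congr ((gridCell_ae_eq_gridCube hh z).symm.inter ae_eq_rfl)

theorem isDyadic_gridCube (k : ℤ) (hh : 0 < (2 : ℝ) ^ (-k)) (z : Fin n → ℤ) :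
    (gridCube ((2 : ℝ) ^ (-k)) hh z).IsDyadic :=
  ⟨rfl, k, z, rfl, fun _ => rfl⟩

/-- Grid cubes whose indices differ by one unit step are consecutive. -/
theorem consecutive_gridCube (hh : 0 < h) {z w : Fin n → ℤ} {i : Fin n}
    (hw : w = Function.update z i (z i + 1)) :
    (gridCube h hh z).Consecutive (gridCube h hh w) := by
  have hi : (w i : ℝ) * h = z i * h + h := by simp [hw, add_mul]
  have hj (j : Fin n) (hj : j ≠ i) : w j = z j := by simp [hw, hj]
  have hin (v : Fin n → ℤ) (x : EuclideanSpace ℝ (Fin n)) :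
      inner ℝ ((gridCube h hh v).frame i) (x - (gridCube h hh v).corner) = x i - v i * h := by
    simp [gridCube, gridPoint, EuclideanSpace.inner_single_left]
  have hside (v : Fin n → ℤ) : (gridCube h hh v).side = h := rfl
  refine ⟨rfl, ⟨i, Or.inr ?_⟩, ⟨i, Or.inl ?_⟩⟩ <;>
  · rw [(EuclCube.isClosed_toSet _).closure_eq, (EuclCube.isClosed_toSet _).closure_eq]
    ext x
    simp only [Set.mem_inter_iff, Set.mem_ofPred_eq, mem_gridCube, hin, hside]
    constructor
    · rintro ⟨h1, h2⟩
      refine ⟨by assumption, ?_⟩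
      have h3 := (h1 i).2
      have h4 := (h2 i).1
      linarith
    · rintro ⟨h1, h2⟩
      refine ⟨fun j => ?_, fun j => ?_⟩ <;>
      · have h1j := h1 j
        by_cases hji : j = i
        · subst hji
          constructor <;> linarith
        · simpa [hj j hji] using h1j

/-- A function on `ℤⁿ` whose unit steps are at most `ε` is `ε`-Lipschitz for the `ℓ¹` distance. -/
theorem abs_sub_le_of_step {g : (Fin n → ℤ) → ℝ} {ε : ℝ}
    (hg : ∀ z i, |g z - g (Function.update z i (z i + 1))| ≤ ε) (z w : Fin n → ℤ) :
    |g z - g w| ≤ (∑ i, (z i - w i).natAbs : ℕ) * ε := by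
  induction hN : ∑ i, (z i - w i).natAbs generalizing z with
  | zero =>
    have : z = w := by
      funext i
      have := Finset.sum_eq_zero_iff.1 hN i (Finset.mem_univ i)
      omega
    simp [this]
  | succ N ih =>
    obtain ⟨i, hi⟩ : ∃ i, z i ≠ w i := by
      by_contra! hcon
      simp [hcon] at hN
    -- a unit step in the direction `i` from `z` towards `w`
    obtain ⟨z', a, rfl, ha, hstep⟩ : ∃ (z' : Fin n → ℤ) (a : ℤ), z' = Function.update z i a ∧
        (a - w i).natAbs + 1 = (z i - w i).natAbs ∧ |g z - g z'| ≤ ε := by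
      rcases lt_or_gt_of_ne hi with hlt | hlt
      · exact ⟨_, z i + 1, rfl, by omega, hg z i⟩
      · refine ⟨_, z i - 1, rfl, by omega, ?_⟩
        have := hg (Function.update z i (z i - 1)) i
        rw [abs_sub_comm]
        simpa using this
    have hsum : ∑ j, (Function.update z i a j - w j).natAbs = N := by
      rw [← Finset.add_sum_erase _ _ (Finset.mem_univ i)] at hN ⊢
      have : ∑ j ∈ Finset.univ.erase i, (Function.update z i a j - w j).natAbs =
          ∑ j ∈ Finset.univ.erase i, (z j - w j).natAbs :=
        Finset.sum_congr rfl fun j hj => by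
          rw [Function.update_of_ne (Finset.ne_of_mem_erase hj)]
      rw [this, Function.update_self]
      omega
    have h2 := ih _ hsum
    have h3 := abs_sub_le (g z) (g (Function.update z i a)) (g w)
    push_cast
    linarith

/-- Indices of grid points at distance at most `R` differ by at most `R / h` in each coordinate. -/
theorem abs_index_sub_mul_le (hh : 0 < h) {z w : Fin n → ℤ} {R : ℝ}
    (hR : ‖gridPoint h z - gridPoint h w‖ ≤ R) (i : Fin n) :
    |((z i - w i : ℤ) : ℝ)| * h ≤ R := by
  have h1 := (abs_inner_le_norm (EuclideanSpace.basisFun (Fin n) ℝ)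
    (gridPoint h z - gridPoint h w) i).trans hR
  have h2 : inner ℝ (EuclideanSpace.basisFun (Fin n) ℝ i) (gridPoint h z - gridPoint h w) =
      ((z i - w i : ℤ) : ℝ) * h := by
    simp [gridPoint, EuclideanSpace.inner_single_left, sub_mul]
  rwa [h2, abs_mul, abs_of_pos hh] at h1

end Grid

/-! ### Density in a cube from densities in the cells inside it -/

namespace EuclCube

variable {n : ℕ}

theorem finite_setOf_gridCell_subset (Q : EuclCube n) {h : ℝ} (hh : 0 < h) :
    {z : Fin n → ℤ | gridCell h z ⊆ Q.toSet}.Finite := by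
  rcases Set.eq_empty_or_nonempty {z : Fin n → ℤ | gridCell h z ⊆ Q.toSet} with he | ⟨w, hw⟩
  · simp [he]
  obtain ⟨M, hM⟩ := exists_nat_ge (n * Q.side / h)
  refine (Set.finite_Icc (fun i => w i - M) (fun i => w i + M)).subset fun z hz => ?_
  have key (i : Fin n) : |z i - w i| ≤ M := by
    have h1 := abs_index_sub_mul_le hh
      (norm_sub_le (hz (gridPoint_mem_gridCell hh z)) (hw (gridPoint_mem_gridCell hh w))) i
    have h2 := ((le_div_iff₀ hh).2 h1).trans hM
    exact_mod_cast h2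
  exact ⟨fun i => by have := abs_le.1 (key i); dsimp only; omega,
    fun i => by have := abs_le.1 (key i); dsimp only; omega⟩

/-- If `A` has density within `η` of `c` in every grid cell inside `Q`, then its density in `Q` is
within `η` of `c`, up to the proportion of `Q` which is not covered by these cells. -/
theorem abs_density_sub_le (A : Set (EuclideanSpace ℝ (Fin n))) (Q : EuclCube n) {h c η : ℝ}
    (hh : 0 < h) (hQ : 2 * (n * h) ≤ Q.side) (hc : c ∈ Set.Icc (0 : ℝ) 1) (hη : 0 ≤ η)
    (hcell : ∀ z : Fin n → ℤ, gridCell h z ⊆ Q.toSet →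
      |(gridCube h hh z).density A - c| ≤ η) :
    |Q.density A - c| ≤ η + n * (2 * (n * h) / Q.side) := by
  set ν := volume.restrict A with hν
  have hl := Q.side_pos
  have hν_le (s : Set (EuclideanSpace ℝ (Fin n))) (hs : volume s ≠ ⊤) :
      ν.real s ≤ volume.real s :=
    ENNReal.toReal_mono hs (Measure.restrict_apply_le _ _)
  obtain ⟨S, hS⟩ : ∃ S : Finset (Fin n → ℤ), ∀ z, z ∈ S ↔ gridCell h z ⊆ Q.toSet :=
    ⟨(Q.finite_setOf_gridCell_subset hh).toFinset, fun z => by simp⟩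
  set U : Set (EuclideanSpace ℝ (Fin n)) := ⋃ z ∈ S, gridCell h z with hU
  have hUQ : U ⊆ Q.toSet := Set.iUnion₂_subset fun z hz => (hS z).1 hz
  have hUm : MeasurableSet U := Finset.measurableSet_biUnion _ fun z _ => measurableSet_gridCell z
  have hdisj : (S : Set (Fin n → ℤ)).PairwiseDisjoint (gridCell h) := fun z _ w _ hzw =>
    Set.disjoint_left.2 fun x hz hw => hzw (eq_of_mem_gridCell hh hz hw)
  have hQt := Q.volume_toSet_ne_top
  have hQν : ν Q.toSet ≠ ⊤ := ne_top_of_le_ne_top hQt (Measure.restrict_apply_le _ _)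
  have hcell_top (z : Fin n → ℤ) : volume (gridCell h z) ≠ ⊤ := by simp [volume_gridCell]
  have hcellν_top (z : Fin n → ℤ) : ν (gridCell h z) ≠ ⊤ :=
    ne_top_of_le_ne_top (hcell_top z) (Measure.restrict_apply_le _ _)
  have hUvol : volume.real U = ∑ z ∈ S, h ^ n := by
    rw [hU, measureReal_biUnion_finset hdisj (fun z _ => measurableSet_gridCell z)
      (fun z _ => hcell_top z)]
    exact Finset.sum_congr rfl fun z _ => volume_real_gridCell hh z
  have hUν : ν.real U = ∑ z ∈ S, ν.real (gridCell h z) :=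
    measureReal_biUnion_finset hdisj (fun z _ => measurableSet_gridCell z)
      (fun z _ => hcellν_top z)
  have hinner : |ν.real U - c * volume.real U| ≤ η * volume.real U := by
    rw [hUν, hUvol, Finset.mul_sum, Finset.mul_sum, ← Finset.sum_sub_distrib]
    refine (Finset.abs_sum_le_sum_abs _ _).trans (Finset.sum_le_sum fun z hz => ?_)
    have hp : 0 < h ^ n := pow_pos hh n
    have h1 := hcell z ((hS z).1 hz)
    rw [density_gridCube] at h1
    calc |ν.real (gridCell h z) - c * h ^ n|
        = |ν.real (gridCell h z) / h ^ n - c| * h ^ n := by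
          rw [← abs_of_pos hp, ← abs_mul, abs_of_pos hp, sub_mul, div_mul_cancel₀ _ hp.ne']
      _ ≤ η * h ^ n := by gcongr
  -- the cells inside `Q` cover the points of `Q` at distance at least `n h` from the boundary
  have hshrink : {x : EuclideanSpace ℝ (Fin n) | ∀ i, inner ℝ (Q.frame i) (x - Q.corner) ∈
      Set.Icc (n * h) (Q.side - n * h)} ⊆ U := by
    intro x hx
    obtain ⟨z, hz⟩ := exists_mem_gridCell hh x
    refine Set.mem_iUnion₂.2 ⟨z, (hS z).2 fun y hy i => ?_, hz⟩
    have h1 := hx i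
    have h2 := abs_le.1 ((abs_inner_le_norm Q.frame (y - x) i).trans
      (norm_sub_le_of_mem_gridCell hy hz))
    rw [show y - Q.corner = (y - x) + (x - Q.corner) by abel, inner_add_right]
    constructor <;> linarith [h1.1, h1.2, h2.1, h2.2]
  have hUlow : (Q.side - 2 * (n * h)) ^ n ≤ volume.real U := by
    have h1 := measureReal_mono (μ := volume) hshrink (measure_ne_top_of_subset hUQ hQt)
    rw [measureReal_def, volume_setOf_inner_sub_mem] at h1
    rw [show Q.side - 2 * (n * h) = Q.side - n * h - n * h by ring]
    simpa [ENNReal.toReal_pow, ENNReal.toReal_ofReal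
      (show 0 ≤ Q.side - n * h - n * h by linarith)] using h1
  have hdiff : volume.real (Q.toSet \ U) = Q.side ^ n - volume.real U := by
    rw [measureReal_sdiff hUQ hUm hQt, Q.volume_real_toSet]
  have hdiffν : ν.real (Q.toSet \ U) = ν.real Q.toSet - ν.real U :=
    measureReal_sdiff hUQ hUm hQν
  have hdiff_le : volume.real (Q.toSet \ U) ≤ n * (2 * (n * h) / Q.side) * Q.side ^ n := by
    have h0 : 2 * (n * h) / Q.side ≤ 1 := (div_le_one hl).2 hQ
    have h1 := one_add_mul_le_pow (a := -(2 * (n * h) / Q.side)) (by linarith) n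
    have h2 : (Q.side - 2 * (n * h)) ^ n = (1 + -(2 * (n * h) / Q.side)) ^ n * Q.side ^ n := by
      rw [← mul_pow]
      congr 1
      field_simp
      ring
    have h3 := mul_le_mul_of_nonneg_right h1 (pow_pos hl n).le
    rw [hdiff]
    linarith
  have houter : |ν.real (Q.toSet \ U) - c * volume.real (Q.toSet \ U)| ≤
      volume.real (Q.toSet \ U) := by
    have h1 := hν_le (Q.toSet \ U) (measure_ne_top_of_subset Set.sdiff_subset hQt)
    have h2 : 0 ≤ ν.real (Q.toSet \ U) := measureReal_nonneg
    have h3 : 0 ≤ volume.real (Q.toSet \ U) := measureReal_nonneg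
    rw [abs_le]
    constructor <;> nlinarith [hc.1, hc.2]
  have hQν_eq : volume.real (A ∩ Q.toSet) = ν.real Q.toSet := by
    rw [hν, measureReal_restrict_apply Q.isClosed_toSet.measurableSet, Set.inter_comm]
  have hp : 0 < Q.side ^ n := pow_pos hl n
  have hU_le : η * volume.real U ≤ η * Q.side ^ n := by
    have : 0 ≤ volume.real (Q.toSet \ U) := measureReal_nonneg
    exact mul_le_mul_of_nonneg_left (by linarith) hη
  have htotal : |ν.real Q.toSet - c * Q.side ^ n| ≤
      (η + n * (2 * (n * h) / Q.side)) * Q.side ^ n := by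
    rw [show ν.real Q.toSet - c * Q.side ^ n = (ν.real U - c * volume.real U) +
      (ν.real (Q.toSet \ U) - c * volume.real (Q.toSet \ U)) by rw [hdiff, hdiffν]; ring]
    refine (abs_add_le _ _).trans ?_
    linarith
  rw [density, Q.volume_real_toSet, hQν_eq]
  rw [show ν.real Q.toSet / Q.side ^ n - c = (ν.real Q.toSet - c * Q.side ^ n) / Q.side ^ n by
    field_simp, abs_div, abs_of_pos hp, div_le_iff₀ hp]
  exact htotal

theorem density_mem_Icc (A : Set (EuclideanSpace ℝ (Fin n))) (Q : EuclCube n) :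
    Q.density A ∈ Set.Icc (0 : ℝ) 1 := by
  refine ⟨by unfold density; positivity, div_le_one_of_le₀ ?_ measureReal_nonneg⟩
  exact measureReal_mono Set.inter_subset_right Q.volume_toSet_ne_top

end EuclCube

/-! ### From dyadic cubes to arbitrary cubes -/

theorem exists_delta_of_dyadic {n : ℕ} {A : Set (EuclideanSpace ℝ (Fin n))}
    (hD : ∀ ε : ℝ, 0 < ε → ∃ δ : ℝ, 0 < δ ∧ ∀ Q Q' : EuclCube n, Q.IsDyadic → Q'.IsDyadic →
      Q.Consecutive Q' → Q.side < δ → |Q.density A - Q'.density A| ≤ ε)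
    {ε : ℝ} (hε : 0 < ε) :
    ∃ δ : ℝ, 0 < δ ∧ ∀ Q Q' : EuclCube n,
      Q.Consecutive Q' → Q.side < δ → |Q.density A - Q'.density A| ≤ ε := by
  -- the summand `2 n` gives room to move the faces inwards by `n h`; the other one makes the
  -- uncovered proportion of a cube at most `ε / 4`
  obtain ⟨J, hJ⟩ : ∃ J : ℕ, 2 * n + 8 * n ^ 2 / ε < (2 : ℝ) ^ J :=
    pow_unbounded_of_one_lt _ one_lt_two
  have h2J : (0 : ℝ) < 2 ^ J := by positivity
  -- an upper bound for the length of the chains of cells which are used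
  set K : ℕ := n * (4 * n * 2 ^ J) with hK
  have hε' : 0 < ε / (4 * (K + 1)) := by positivity
  obtain ⟨δ, hδ, hδD⟩ := hD _ hε'
  refine ⟨δ, hδ, fun Q Q' hQQ' hQδ => ?_⟩
  obtain ⟨p, hpQ, hpQ'⟩ := hQQ'.exists_mem
  have hl := Q.side_pos
  obtain ⟨m, hm1, hm2⟩ := exists_mem_Ico_zpow hl (one_lt_two (α := ℝ))
  obtain ⟨k, hk⟩ : ∃ k : ℤ, k = J - m := ⟨_, rfl⟩
  have hh : 0 < (2 : ℝ) ^ (-k) := by positivity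
  have hkm : (2 : ℝ) ^ (-k) * 2 ^ J = 2 ^ m := by
    rw [← zpow_natCast, ← zpow_add₀ two_ne_zero, hk]
    congr 1
    ring
  have hisD := isDyadic_gridCube (n := n) k hh
  obtain ⟨h, hhk⟩ : ∃ h : ℝ, h = (2 : ℝ) ^ (-k) := ⟨_, rfl⟩
  simp only [← hhk] at hh hkm hisD
  have hhl : h * 2 ^ J ≤ Q.side := hkm ▸ hm1
  have hlh : Q.side ≤ 2 * (h * 2 ^ J) := by
    rw [zpow_add₀ two_ne_zero, zpow_one] at hm2
    rw [hkm]
    linarith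
  have hh_le : h ≤ Q.side := by
    have : (1 : ℝ) ≤ 2 ^ J := one_le_pow₀ one_le_two
    nlinarith
  have hstep (z : Fin n → ℤ) (i : Fin n) : |(gridCube h hh z).density A -
      (gridCube h hh (Function.update z i (z i + 1))).density A| ≤ ε / (4 * (K + 1)) :=
    hδD _ _ (hisD _) (hisD _) (consecutive_gridCube hh rfl) (hh_le.trans_lt hQδ)
  obtain ⟨w, hw⟩ := exists_mem_gridCell hh p
  set c := (gridCube h hh w).density A with hc
  have main (R : EuclCube n) (hR : R.side = Q.side) (hpR : p ∈ R.toSet) :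
      |R.density A - c| ≤ ε / 2 := by
    have hcell (z : Fin n → ℤ) (hz : gridCell h z ⊆ R.toSet) :
        |(gridCube h hh z).density A - c| ≤ ε / 4 := by
      have hdist : ‖gridPoint h z - gridPoint h w‖ ≤ (4 * n * 2 ^ J : ℕ) * h := by
        have h1 := EuclCube.norm_sub_le (hz (gridPoint_mem_gridCell hh z)) hpR
        have h2 := norm_sub_le_of_mem_gridCell hw (gridPoint_mem_gridCell hh w)
        have h3 := norm_sub_le_norm_sub_add_norm_sub (gridPoint h z) p (gridPoint h w)
        rw [hR] at h1
        have h4 : (n : ℝ) * h ≤ n * Q.side := by gcongr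
        have h5 : (n : ℝ) * Q.side ≤ n * (2 * (h * 2 ^ J)) := by gcongr
        push_cast
        linarith
      have hsum : ∑ i, (z i - w i).natAbs ≤ K := by
        have : ∀ i ∈ (Finset.univ : Finset (Fin n)), (z i - w i).natAbs ≤ 4 * n * 2 ^ J := by
          intro i _
          have h1 := le_of_mul_le_mul_right (abs_index_sub_mul_le hh hdist i) hh
          have h2 : |z i - w i| ≤ ((4 * n * 2 ^ J : ℕ) : ℤ) := by exact_mod_cast h1
          rw [Int.abs_eq_natAbs] at h2
          exact_mod_cast h2
        simpa [hK] using Finset.sum_le_card_nsmul _ _ _ this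
      calc |(gridCube h hh z).density A - c|
          ≤ (∑ i, (z i - w i).natAbs : ℕ) * (ε / (4 * (K + 1))) :=
            abs_sub_le_of_step (g := fun z => (gridCube h hh z).density A) hstep z w
        _ ≤ (K + 1) * (ε / (4 * (K + 1))) := by
            have : ((∑ i, (z i - w i).natAbs : ℕ) : ℝ) ≤ K := by exact_mod_cast hsum
            gcongr
            linarith
        _ = ε / 4 := by field_simp
    have hratio : h / Q.side ≤ 1 / 2 ^ J := by
      rw [div_le_div_iff₀ hl h2J]
      linarith
    have h2n : 2 * (n * h) ≤ R.side := by
      have : (0 : ℝ) ≤ 8 * n ^ 2 / ε := by positivity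
      rw [hR]
      nlinarith
    have hlayer : (n : ℝ) * (2 * (n * h) / R.side) ≤ ε / 4 := by
      have h1 : 8 * n ^ 2 / ε ≤ (2 : ℝ) ^ J := by
        have : (0 : ℝ) ≤ 2 * n := by positivity
        linarith
      rw [div_le_iff₀ hε] at h1
      calc (n : ℝ) * (2 * (n * h) / R.side) = 2 * n ^ 2 * (h / Q.side) := by rw [hR]; ring
        _ ≤ 2 * n ^ 2 * (1 / 2 ^ J) := by gcongr
        _ ≤ ε / 4 := by
          rw [mul_one_div, div_le_iff₀ h2J]
          linarith
    have := R.abs_density_sub_le A hh h2n (EuclCube.density_mem_Icc A _) (by positivity) hcell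
    linarith
  have h1 := main Q rfl hpQ
  have h2 := main Q' hQQ'.1.symm hpQ'
  rw [abs_sub_comm] at h2
  have h3 := abs_sub_le (Q.density A) c (Q'.density A)
  linarith

theorem mainTheorem6 (n : ℕ) (A : Set (EuclideanSpace ℝ (Fin n)))
    (hA : NullMeasurableSet A volume) :
    List.TFAE [
      ∀ ε : ℝ, 0 < ε → ∃ δ : ℝ, 0 < δ ∧ ∀ Q Q' : EuclCube n, Q.IsDyadic → Q'.IsDyadic →
        Q.Consecutive Q' → Q.side < δ → |Q.density A - Q'.density A| ≤ ε,
      ∀ ε : ℝ, 0 < ε → ∃ δ : ℝ, 0 < δ ∧ ∀ Q Q' : EuclCube n,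
        Q.Consecutive Q' → Q.side < δ → |Q.density A - Q'.density A| ≤ ε,
      IsSmoothSet A] := by
  tfae_have 1 → 2 := fun h ε hε => exists_delta_of_dyadic h hε
  tfae_have 2 → 3 := by
    refine fun h => ⟨hA, ENNReal.tendsto_nhds_zero.2 fun ε hε => ?_⟩
    rcases eq_or_ne ε ⊤ with rfl | hε_top
    · simp
    obtain ⟨δ, hδ, hb⟩ := h ε.toReal (ENNReal.toReal_pos hε.ne' hε_top)
    filter_upwards [Ioo_mem_nhdsGT hδ] with t ht
    refine iSup_le fun Q => iSup_le fun Q' => iSup_le fun _ => iSup_le fun _ =>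
      iSup_le fun hQQ' => iSup_le fun hQ => ?_
    exact ENNReal.ofReal_le_of_le_toReal (hb Q Q' hQQ' (hQ.trans_lt ht.2))
  tfae_have 3 → 1 := by
    rintro ⟨-, h⟩ ε hε
    have h1 := ENNReal.tendsto_nhds_zero.1 h (ENNReal.ofReal ε) (ENNReal.ofReal_pos.2 hε)
    obtain ⟨δ, hδ, hsub⟩ := mem_nhdsGT_iff_exists_Ioo_subset.1 h1
    refine ⟨δ, hδ, fun Q Q' hQ hQ' hQQ' hlt => ?_⟩
    have h2 : smoothModulus A Q.side ≤ ENNReal.ofReal ε := hsub ⟨Q.side_pos, hlt⟩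
    refine (ENNReal.ofReal_le_ofReal_iff hε.le).1 (le_trans ?_ h2)
    exact le_iSup_of_le Q <| le_iSup_of_le Q' <| le_iSup_of_le hQ.1 <| le_iSup_of_le hQ'.1 <|
      le_iSup_of_le hQQ' <| le_iSup_of_le le_rfl le_rfl
  tfae_finish
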